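/- **Conventions.** Let $\mathcal K$ be a (strict) 2-category. A lax square $(p,q,f,g,\phi)$ consists of 1-cells $p:P\to A$, $q:P\to B$, $f:A\to C$, $g:B\to C$ and a 2-cell $\phi:fp\Rightarrow gq$. Comma objects, isocomma objects and pullbacks are meant in the strict 2-categorical sense (universal property for 1-cells, with existence, uniqueness and equality on the nose, and for 2-cells); the isocomma object of $f$ and $g$ has the universal property of the comma object, but with respect to invertible 2-cells only. A square with an invertible 2-cell $\phi:fp\cong gq$ is a *bipullback* when the 1-cell which it induces from $P$ to the isocomma object of $f$ and $g$ is an equivalence. A 2-cell $\psi:h\Rightarrow lf$, where $f:A\to C$, $h:A\to V$, $l:C\to V$, exhibits $l$ as a *left Kan extension* of $h$ along $f$ when every 2-cell $h\Rightarrow sf$ is $(\sigma f)\psi$ for a unique $\sigma:l\Rightarrow s$. It exhibits $l$ as a *pointwise left Kan extension* when for every $x:D\to C$, with comma square $\lambda:fp\Rightarrow xq$ of $f$ and $x$, the pasting $(l\lambda)(\psi p):hp\Rightarrow lxq$ exhibits $lx$ as a left Kan extension of $hp$ along $q$. A lax square $\phi:fp\Rightarrow gq$ is *exact* when, for every $\psi:h\Rightarrow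 lf$ that exhibits $l$ as a pointwise left Kan extension of $h$ along $f$, the pasting $(l\phi)(\psi p)$ exhibits $lg$ as a pointwise left Kan extension of $hp$ along $q$. For $f:A\to C$, a 2-cell $\alpha:x\Rightarrow y:X\to A$ is *$f$-cartesian* when for all $k:Y\to X$ the 2-cell $\alpha k$ is a cartesian arrow for the functor $f\circ-:\mathcal K(Y,A)\to\mathcal K(Y,C)$: for all $z:Y\to A$, $\beta:z\Rightarrow yk$ and $\gamma:fz\Rightarrow fxk$ with $(f\alpha k)\gamma=f\beta$ there is a unique $\delta:z\Rightarrow xk$ with $f\delta=\gamma$ and $(\alpha k)\delta=\beta$. The 1-cell $f$ is a *fibration* (respectively a *bi-fibration*) when for all $a:X\to A$, $b:X\to C$ and $\beta:b\Rightarrow fa$ there are $a':X\to A$ with $fa'=b$ (respectively with an invertible 2-cell $\iota:fa'\cong b$) and an $f$-cartesian $\alpha:a'\Rightarrow a$ with $f\alpha=\beta$ (respectively $f\alpha=\beta\iota$). *Opcartesian* 2-cells, *opfibrations* and *bi-opfibrations* are defined dually, by reversing 2-cells. **Proposition.** Let $\mathcal K$ be a 2-category with comma objects and pullbacks. 1.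 A pullback square $fp=gq$, with the identity 2-cell, is exact whenever $f$ is an opfibration or $g$ is a fibration. 2. If moreover $\mathcal K$ has isocomma objects, then a bipullback square $\phi:fp\cong gq$ is exact whenever $f$ is a bi-opfibration or $g$ is a bi-fibration. -/

import Mathlib

/-!
Limits, fibrations, pointwise left Kan extensions and exact squares in a (strict) 2-category,
i.e. a bicategory satisfying `Bicategory.Strict`. Composition `f ≫ g` is written in diagrammatic
order. A lax square has sides `p : W ⟶ A`, `q : W ⟶ B`, `f : A ⟶ C`, `g : B ⟶ C` and is a 2-cell
`lam : p ≫ f ⟶ q ≫ g`. The associators, which are identities of a strict 2-category up to transport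
along equalities, are written out.
-/

open CategoryTheory Bicategory

universe w v u

namespace ExactSquares

section Squares

variable {K : Type u} [Bicategory.{w, v} K]

/-- Restriction of the lax square `lam` along a 1-cell `u : X ⟶ W`. -/
def restrict {W A B C X : K} {f : A ⟶ C} {g : B ⟶ C} {p : W ⟶ A} {q : W ⟶ B} (u : X ⟶ W)
    (lam : p ≫ f ⟶ q ≫ g) : (u ≫ p) ≫ f ⟶ (u ≫ q) ≫ g :=
  (α_ u p f).hom ≫ u ◁ lam ≫ (α_ u q g).inv

/-- The pasting of a lax square `phi : p ≫ f ⟶ q ≫ g` with a triangle `psi : h ⟶ f ≫ l`. -/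
def paste {P A B C V : K} {f : A ⟶ C} {g : B ⟶ C} {p : P ⟶ A} {q : P ⟶ B} {h : A ⟶ V} {l : C ⟶ V}
    (phi : p ≫ f ⟶ q ≫ g) (psi : h ⟶ f ≫ l) : p ≫ h ⟶ q ≫ (g ≫ l) :=
  p ◁ psi ≫ (α_ p f l).inv ≫ phi ▷ l ≫ (α_ q g l).hom

/-- The two-dimensional part of the universal properties of comma objects, isocomma objects and
pullbacks: 2-cells `u ⟶ v` between maps into the vertex `W` correspond bijectively to pairs of
2-cells between the composites with the projections that are compatible with the square. -/
def LiftsTwoCells {W A B C : K} {f : A ⟶ C} {g : B ⟶ C} {p : W ⟶ A} {q : W ⟶ B}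
    (lam : p ≫ f ⟶ q ≫ g) : Prop :=
  ∀ ⦃X : K⦄ (u v : X ⟶ W) (σ : u ≫ p ⟶ v ≫ p) (τ : u ≫ q ⟶ v ≫ q),
    σ ▷ f ≫ restrict v lam = restrict u lam ≫ τ ▷ g →
      ∃! θ : u ⟶ v, θ ▷ p = σ ∧ θ ▷ q = τ

/-- `u : X ⟶ W` satisfies `u ≫ p = a`, `u ≫ q = b`, and the restriction of `lam` along `u` is
`alpha` (up to transport along these two equalities). -/
def Induces {W A B C X : K} {f : A ⟶ C} {g : B ⟶ C} {p : W ⟶ A} {q : W ⟶ B}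
    (lam : p ≫ f ⟶ q ≫ g) {a : X ⟶ A} {b : X ⟶ B} (alpha : a ≫ f ⟶ b ≫ g) (u : X ⟶ W) : Prop :=
  ∃ (ha : u ≫ p = a) (hb : u ≫ q = b),
    restrict u lam ≫ eqToHom hb ▷ g = eqToHom ha ▷ f ≫ alpha

/-- `lam` is a comma square: it exhibits `W` as the comma object of `f` and `g`. -/
structure IsComma {W A B C : K} (f : A ⟶ C) (g : B ⟶ C) (p : W ⟶ A) (q : W ⟶ B)
    (lam : p ≫ f ⟶ q ≫ g) : Prop where
  existsUnique_lift : ∀ ⦃X : K⦄ (a : X ⟶ A) (b : X ⟶ B) (alpha : a ≫ f ⟶ b ≫ g),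
    ∃! u : X ⟶ W, Induces lam alpha u
  liftsTwoCells : LiftsTwoCells lam

/-- `lam` is an isocomma square: it exhibits `W` as the isocomma object of `f` and `g`. -/
structure IsIsocomma {W A B C : K} (f : A ⟶ C) (g : B ⟶ C) (p : W ⟶ A) (q : W ⟶ B)
    (lam : p ≫ f ≅ q ≫ g) : Prop where
  existsUnique_lift : ∀ ⦃X : K⦄ (a : X ⟶ A) (b : X ⟶ B) (alpha : a ≫ f ≅ b ≫ g),
    ∃! u : X ⟶ W, Induces lam.hom alpha.hom u
  liftsTwoCells : LiftsTwoCells lam.hom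

/-- A pseudo-commuting square `phi` is a bipullback when the 1-cell that it induces into the
isocomma object of `f` and `g` is an equivalence. -/
def IsBipullback {P A B C : K} (f : A ⟶ C) (g : B ⟶ C) (p : P ⟶ A) (q : P ⟶ B)
    (phi : p ≫ f ≅ q ≫ g) : Prop :=
  ∃ (W : K) (p' : W ⟶ A) (q' : W ⟶ B) (lam : p' ≫ f ≅ q' ≫ g),
    IsIsocomma f g p' q' lam ∧ ∃ e : P ≌ W, Induces lam.hom phi.hom e.hom

/-- `psi` exhibits `l` as a left Kan extension of `h` along `f`. -/
def IsLan {A C V : K} (f : A ⟶ C) (h : A ⟶ V) (l : C ⟶ V) (psi : h ⟶ f ≫ l) : Prop :=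
  Nonempty (LeftExtension.mk l psi).IsKan

/-- `psi` exhibits `l` as a pointwise left Kan extension of `h` along `f` (Street): pasting `psi`
with the comma square of `f` along any `x : D ⟶ C` gives a left Kan extension. -/
def IsPointwiseLan {A C V : K} (f : A ⟶ C) (h : A ⟶ V) (l : C ⟶ V) (psi : h ⟶ f ≫ l) : Prop :=
  ∀ ⦃D W : K⦄ (x : D ⟶ C) (p : W ⟶ A) (q : W ⟶ D) (lam : p ≫ f ⟶ q ≫ x),
    IsComma f x p q lam → IsLan q (p ≫ h) (x ≫ l) (paste lam psi)

/-- The lax square `phi` is exact: pasting with it preserves pointwise left Kan extensions. -/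
def IsExact {P A B C : K} (f : A ⟶ C) (g : B ⟶ C) (p : P ⟶ A) (q : P ⟶ B)
    (phi : p ≫ f ⟶ q ≫ g) : Prop :=
  ∀ ⦃V : K⦄ (h : A ⟶ V) (l : C ⟶ V) (psi : h ⟶ f ≫ l),
    IsPointwiseLan f h l psi → IsPointwiseLan q (p ≫ h) (g ≫ l) (paste phi psi)

/-- The 2-cell `alpha : x ⟶ y` between 1-cells `X ⟶ A` is `f`-cartesian: for every `k : Y ⟶ X`,
its restriction along `k` is a cartesian arrow for the functor `K(Y, A) ⥤ K(Y, C)` given by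
composition with `f`. -/
def IsCartesian {A C X : K} (f : A ⟶ C) {x y : X ⟶ A} (alpha : x ⟶ y) : Prop :=
  ∀ ⦃Y : K⦄ (k : Y ⟶ X) (z : Y ⟶ A) (β : z ⟶ k ≫ y) (γ : z ≫ f ⟶ (k ≫ x) ≫ f),
    γ ≫ (k ◁ alpha) ▷ f = β ▷ f → ∃! δ : z ⟶ k ≫ x, δ ▷ f = γ ∧ δ ≫ k ◁ alpha = β

/-- The dual notion: `alpha : x ⟶ y` is `f`-opcartesian. -/
def IsOpcartesian {A C X : K} (f : A ⟶ C) {x y : X ⟶ A} (alpha : x ⟶ y) : Prop :=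
  ∀ ⦃Y : K⦄ (k : Y ⟶ X) (z : Y ⟶ A) (β : k ≫ x ⟶ z) (γ : (k ≫ y) ≫ f ⟶ z ≫ f),
    (k ◁ alpha) ▷ f ≫ γ = β ▷ f → ∃! δ : k ≫ y ⟶ z, δ ▷ f = γ ∧ k ◁ alpha ≫ δ = β

/-- `f` is a fibration: every `β : b ⟶ a ≫ f` has an `f`-cartesian lift. -/
def IsFibration {A C : K} (f : A ⟶ C) : Prop :=
  ∀ ⦃X : K⦄ (a : X ⟶ A) (b : X ⟶ C) (β : b ⟶ a ≫ f),
    ∃ (a' : X ⟶ A) (hb : a' ≫ f = b) (alpha : a' ⟶ a),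
      IsCartesian f alpha ∧ alpha ▷ f = eqToHom hb ≫ β

/-- `f` is an opfibration: every `β : a ≫ f ⟶ b` has an `f`-opcartesian lift. -/
def IsOpfibration {A C : K} (f : A ⟶ C) : Prop :=
  ∀ ⦃X : K⦄ (a : X ⟶ A) (b : X ⟶ C) (β : a ≫ f ⟶ b),
    ∃ (a' : X ⟶ A) (hb : b = a' ≫ f) (alpha : a ⟶ a'),
      IsOpcartesian f alpha ∧ alpha ▷ f = β ≫ eqToHom hb

/-- `f` is a bi-fibration: every `β : b ⟶ a ≫ f` has an `f`-cartesian lift up to isomorphism. -/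
def IsBiFibration {A C : K} (f : A ⟶ C) : Prop :=
  ∀ ⦃X : K⦄ (a : X ⟶ A) (b : X ⟶ C) (β : b ⟶ a ≫ f),
    ∃ (a' : X ⟶ A) (ι : a' ≫ f ≅ b) (alpha : a' ⟶ a),
      IsCartesian f alpha ∧ alpha ▷ f = ι.hom ≫ β

/-- `f` is a bi-opfibration: every `β : a ≫ f ⟶ b` has an `f`-opcartesian lift up to
isomorphism. -/
def IsBiOpfibration {A C : K} (f : A ⟶ C) : Prop :=
  ∀ ⦃X : K⦄ (a : X ⟶ A) (b : X ⟶ C) (β : a ≫ f ⟶ b),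
    ∃ (a' : X ⟶ A) (ι : b ≅ a' ≫ f) (alpha : a ⟶ a'),
      IsOpcartesian f alpha ∧ alpha ▷ f = β ≫ ι.hom

variable (K)

/-- `K` has comma objects. -/
def HasCommaObjects : Prop :=
  ∀ ⦃A B C : K⦄ (f : A ⟶ C) (g : B ⟶ C),
    ∃ (W : K) (p : W ⟶ A) (q : W ⟶ B) (lam : p ≫ f ⟶ q ≫ g), IsComma f g p q lam

/-- `K` has isocomma objects. -/
def HasIsocommaObjects : Prop :=
  ∀ ⦃A B C : K⦄ (f : A ⟶ C) (g : B ⟶ C),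
    ∃ (W : K) (p : W ⟶ A) (q : W ⟶ B) (lam : p ≫ f ≅ q ≫ g), IsIsocomma f g p q lam

end Squares

section TwoCategories

variable {K : Type u} [Bicategory.{w, v} K] [Bicategory.Strict K]

/-- The square with sides `p, q, f, g` is a pullback in the 2-category `K`: it is a pullback in the
underlying category, and it satisfies the two-dimensional universal property. -/
structure IsTwoPullback {P A B C : K} (f : A ⟶ C) (g : B ⟶ C) (p : P ⟶ A) (q : P ⟶ B) : Prop where
  isPullback : IsPullback p q f g
  liftsTwoCells : LiftsTwoCells (f := f) (g := g) (eqToHom isPullback.w)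

variable (K)

/-- `K` has pullbacks (in the 2-categorical sense). -/
def HasTwoPullbacks : Prop :=
  ∀ ⦃A B C : K⦄ (f : A ⟶ C) (g : B ⟶ C),
    ∃ (P : K) (p : P ⟶ A) (q : P ⟶ B), IsTwoPullback f g p q

end TwoCategories

end ExactSquares

namespace ExactSquares

/-! ### Kan extensions and restriction along a 1-cell -/

section Weak

variable {K : Type u} [Bicategory.{w, v} K]

/-! Fix `x : D ⟶ B` and let `W`, `W'` be the comma objects of `q, x` and of `f, x ≫ g`. Pasting with
`phi` induces `u : W ⟶ W'` over `D`. A Kan extension along `q' : W' ⟶ D` is given by hypothesis, and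
it restricts to one along `W ⟶ D` as soon as whiskering with `u` is bijective on 2-cells into any
`q' ≫ t`.

For this, the (op)fibration factors the comma square on `W'` as a 2-cell `σ`, then `phi`, then a
`g`-cartesian `τ` (`FactorsLaxSquares`); `τ` induces `v : W' ⟶ W`. There are 2-cells `η : 𝟙 ⟶ v ≫
u`, made from `σ` and inverted by `q'`, and `θ : 𝟙 ⟶ u ≫ v`, made from cartesianness of `τ`, which
agree after whiskering with `u`. No adjunction is needed: `whiskerLeft_bijective` concludes from
these data. `FactorsLaxSquares.isExact` thus covers pullbacks and bipullbacks alike. -/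

theorem isLan_iff {A C V : K} {f : A ⟶ C} {h : A ⟶ V} {l : C ⟶ V} {psi : h ⟶ f ≫ l} :
    IsLan f h l psi ↔ ∀ s : C ⟶ V, Function.Bijective fun σ : l ⟶ s => psi ≫ f ◁ σ := by
  constructor
  · rintro ⟨hk⟩ s
    exact ⟨fun σ σ' e => hk.hom_ext e, fun τ => ⟨hk.desc (.mk s τ), hk.fac (.mk s τ)⟩⟩
  · intro hb
    choose d hd using fun s : LeftExtension f h => (hb s.extension).2 s.unit
    exact ⟨.mk (fun s => LeftExtension.homMk (d s) (hd s)) fun s τ =>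
      StructuredArrow.ext _ _ ((hb s.extension).1 ((LeftExtension.w τ).trans (hd s).symm))⟩

theorem isLan_of_whiskerLeft_bijective {W W' D V : K} {q : W' ⟶ D} {s : W ⟶ D} {u : W ⟶ W'}
    (ub : u ≫ q ≅ s) {H : W' ⟶ V} {H' : W ⟶ V} (ha : u ≫ H ≅ H') {L L' : D ⟶ V} (c : L ≅ L')
    {Ψ : H ⟶ q ≫ L} {Ψ' : H' ⟶ s ≫ L'} (hΨ : IsLan q H L Ψ)
    (hu : ∀ t : D ⟶ V, Function.Bijective fun σ : H ⟶ q ≫ t => u ◁ σ)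
    (hΨ' : ha.hom ≫ Ψ' = u ◁ Ψ ≫ (α_ u q L).inv ≫ ub.hom ▷ L ≫ s ◁ c.hom) :
    IsLan s H' L' Ψ' := by
  rw [isLan_iff] at hΨ ⊢
  intro t
  have hc : Function.Bijective fun σ : L' ⟶ t => c.hom ≫ σ := (c.homFromEquiv (Z := t)).symm.bijective
  have hr : Function.Bijective fun τ : u ≫ H ⟶ u ≫ q ≫ t =>
      ha.inv ≫ τ ≫ (α_ u q t).inv ≫ ub.hom ▷ t :=
    (ha.homCongr ((α_ u q t).symm ≪≫ whiskerRightIso ub t)).bijective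
  convert hr.comp ((hu t).comp ((hΨ t).comp hc)) using 1
  funext σ
  have : Ψ' = ha.inv ≫ u ◁ Ψ ≫ (α_ u q L).inv ≫ ub.hom ▷ L ≫ s ◁ c.hom := by
    rw [← hΨ', ha.inv_hom_id_assoc]
  have hx : ub.hom ▷ L ≫ s ◁ (c.hom ≫ σ) = (u ≫ q) ◁ (c.hom ≫ σ) ≫ ub.hom ▷ t :=
    (whisker_exchange _ _).symm
  simp only [whiskerLeft_comp, comp_whiskerLeft, Category.assoc] at hx
  simp [this, hx]

/-- Naturality of `η` recovers `σ` from `u ◁ σ` because `η ▷ G` is invertible; the same formula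
defines a preimage of any `τ`. That it is a preimage follows by trading `u ◁ η` for `θ ▷ u` and
using naturality of `θ`. -/
theorem whiskerLeft_bijective {W W' V : K} (u : W ⟶ W') (v : W' ⟶ W) (η : 𝟙 W' ⟶ v ≫ u)
    (θ : 𝟙 W ⟶ u ≫ v) (h : (λ_ u).inv ≫ θ ▷ u ≫ (α_ u v u).hom = (ρ_ u).inv ≫ u ◁ η)
    (H G : W' ⟶ V) [IsIso (η ▷ G)] : Function.Bijective fun σ : H ⟶ G => u ◁ σ := by
  have key (F : W' ⟶ V) : u ◁ ((λ_ F).inv ≫ η ▷ F ≫ (α_ v u F).hom) =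
      (λ_ (u ≫ F)).inv ≫ θ ▷ (u ≫ F) ≫ (α_ u v (u ≫ F)).hom := by
    have := congrArg (fun z => z ▷ F ≫ (α_ _ _ _).hom ≫ u ◁ (α_ _ _ _).hom) h
    refine Eq.trans ?_ (this.symm.trans ?_) <;> bicategory
  constructor
  · intro σ σ' e
    have hn (ρ : H ⟶ G) : (λ_ H).hom ≫ ρ ≫ (λ_ G).inv ≫ η ▷ G =
        η ▷ H ≫ (α_ v u H).hom ≫ v ◁ u ◁ ρ ≫ (α_ v u G).inv := by
      rw [← comp_whiskerLeft, ← whisker_exchange]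
      simp
    have := (hn σ).trans (Eq.trans (by rw [show u ◁ σ = u ◁ σ' from e]) (hn σ').symm)
    simp only [← Category.assoc] at this
    simp only [Category.assoc, Iso.cancel_iso_hom_left] at this
    exact (cancel_mono ((λ_ G).inv ≫ η ▷ G)).1 this
  · intro τ
    let σ : H ⟶ G := (λ_ H).inv ≫ η ▷ H ≫ (α_ v u H).hom ≫ v ◁ τ ≫ (α_ v u G).inv ≫
      inv (η ▷ G) ≫ (λ_ G).hom
    have hσ : σ ≫ (λ_ G).inv ≫ η ▷ G ≫ (α_ v u G).hom =
      ((λ_ H).inv ≫ η ▷ H ≫ (α_ v u H).hom) ≫ v ◁ τ := by simp [σ]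
    refine ⟨σ, ?_⟩
    have := congrArg (u ◁ ·) hσ
    rw [whiskerLeft_comp, whiskerLeft_comp u _ (v ◁ τ), key, key] at this
    have e2 : ((λ_ (u ≫ H)).inv ≫ θ ▷ (u ≫ H) ≫ (α_ u v (u ≫ H)).hom) ≫ u ◁ v ◁ τ =
        τ ≫ (λ_ (u ≫ G)).inv ≫ θ ▷ (u ≫ G) ≫ (α_ u v (u ≫ G)).hom := by
      have := whisker_exchange θ τ
      simp only [id_whiskerLeft, comp_whiskerLeft] at this
      simp only [Category.assoc] at this ⊢
      rw [← cancel_epi (λ_ (u ≫ H)).hom, ← cancel_mono (α_ u v (u ≫ G)).inv]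
      simpa using this.symm
    rw [e2] at this
    have hm : IsIso ((λ_ (u ≫ G)).inv ≫ θ ▷ (u ≫ G) ≫ (α_ u v (u ≫ G)).hom) := by
      rw [← key]; infer_instance
    exact (cancel_mono _).1 this

end Weak

/-! ### Exactness from factorization of lax squares -/

section Exactness

variable {K : Type u} [Bicategory.{w, v} K]

theorem LiftsTwoCells.hom_ext {W A B C X : K} {f : A ⟶ C} {g : B ⟶ C} {p : W ⟶ A} {q : W ⟶ B}
    {lam : p ≫ f ⟶ q ≫ g} (h : LiftsTwoCells lam) {u v : X ⟶ W} {θ θ' : u ⟶ v}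
    (hp : θ ▷ p = θ' ▷ p) (hq : θ ▷ q = θ' ▷ q) : θ = θ' := by
  refine (h u v (θ ▷ p) (θ ▷ q) ?_).unique ⟨rfl, rfl⟩ ⟨hp.symm, hq.symm⟩
  simp only [restrict, Category.assoc]
  rw [associator_naturality_left_assoc, ← whisker_exchange_assoc, associator_inv_naturality_left]

theorem Induces.exists_iso {W A B C X : K} {f : A ⟶ C} {g : B ⟶ C} {p : W ⟶ A} {q : W ⟶ B}
    {lam : p ≫ f ⟶ q ≫ g} {a : X ⟶ A} {b : X ⟶ B} {alpha : a ≫ f ⟶ b ≫ g} {u : X ⟶ W}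
    (h : Induces lam alpha u) : ∃ (ia : u ≫ p ≅ a) (ib : u ≫ q ≅ b),
      restrict u lam ≫ ib.hom ▷ g = ia.hom ▷ f ≫ alpha := by
  obtain ⟨ha, hb, e⟩ := h
  exact ⟨eqToIso ha, eqToIso hb, e⟩

theorem IsComma.exists_lift {W A B C X : K} {f : A ⟶ C} {g : B ⟶ C} {p : W ⟶ A} {q : W ⟶ B}
    {lam : p ≫ f ⟶ q ≫ g} (h : IsComma f g p q lam) (a : X ⟶ A) (b : X ⟶ B)
    (alpha : a ≫ f ⟶ b ≫ g) : ∃ (u : X ⟶ W) (ia : u ≫ p ≅ a) (ib : u ≫ q ≅ b),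
      restrict u lam ≫ ib.hom ▷ g = ia.hom ▷ f ≫ alpha :=
  let ⟨u, hu, _⟩ := h.existsUnique_lift a b alpha
  ⟨u, hu.exists_iso⟩

/-- Every lax square over the cospan `f`, `g` factors through `phi`, up to a 2-cell on the side of
`f` and a `g`-cartesian 2-cell on the side of `g`. -/
def FactorsLaxSquares {P A B C : K} {f : A ⟶ C} {g : B ⟶ C} {p : P ⟶ A} {q : P ⟶ B}
    (phi : p ≫ f ⟶ q ≫ g) : Prop :=
  ∀ ⦃X : K⦄ (a : X ⟶ A) (b : X ⟶ B) (β : a ≫ f ⟶ b ≫ g),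
    ∃ (m : X ⟶ P) (σ : a ⟶ m ≫ p) (τ : m ≫ q ⟶ b),
      IsCartesian g τ ∧ σ ▷ f ≫ restrict m phi ≫ τ ▷ g = β

theorem FactorsLaxSquares.isExact (hcomma : HasCommaObjects K) {P A B C : K} {f : A ⟶ C}
    {g : B ⟶ C} {p : P ⟶ A} {q : P ⟶ B} {phi : p ≫ f ⟶ q ≫ g} [IsIso phi]
    (hphi : LiftsTwoCells phi) (hfac : FactorsLaxSquares phi) : IsExact f g p q phi := by
  intro V h l psi hpsi D W x r s lam hlam
  obtain ⟨W', p', q', lam', hlam'⟩ := hcomma f (x ≫ g)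
  have hK := hpsi (x ≫ g) p' q' lam' hlam'
  obtain ⟨u, ua, ub, hu⟩ := hlam'.exists_lift (r ≫ p) s
    ((α_ r p f).hom ≫ r ◁ phi ≫ (α_ r q g).inv ≫ lam ▷ g ≫ (α_ s x g).hom)
  obtain ⟨m, σ, τ, hτ, hστ⟩ := hfac p' (q' ≫ x) (lam' ≫ (α_ q' x g).inv)
  obtain ⟨v, va, vb, hv⟩ := hlam.exists_lift m q' τ
  have hu' : u ◁ lam' = (α_ u p' f).inv ≫ (ua.hom ▷ f ≫ (α_ r p f).hom ≫ r ◁ phi ≫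
      (α_ r q g).inv ≫ lam ▷ g ≫ (α_ s x g).hom ≫ ub.inv ▷ (x ≫ g)) ≫ (α_ u q' (x ≫ g)).hom := by
    have := hu =≫ (ub.inv ▷ (x ≫ g))
    simp only [restrict, Category.assoc, hom_inv_whiskerRight, Category.comp_id] at this
    rw [← this]
    simp
  have hv' : v ◁ lam = (α_ v r q).inv ≫ (va.hom ▷ q ≫ τ ≫ vb.inv ▷ x) ≫ (α_ v s x).hom := by
    have := hv =≫ (vb.inv ▷ x)
    simp only [restrict, Category.assoc, hom_inv_whiskerRight, Category.comp_id] at this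
    rw [Category.assoc, Category.assoc, ← reassoc_of% this]
    simp
  have hστ' : σ ▷ f ≫ (α_ m p f).hom ≫ m ◁ phi ≫ (α_ m q g).inv ≫ τ ▷ g ≫ (α_ q' x g).hom =
      lam' := by
    have := hστ =≫ (α_ q' x g).hom
    simpa [restrict] using this
  -- Up to coherence and the isomorphisms of the lifts, `η` is `σ` over `A` and the identity over
  -- `D`.
  obtain ⟨η, ⟨hηp, hηq⟩, -⟩ := hlam'.liftsTwoCells (𝟙 W') (v ≫ u)
    ((λ_ p').hom ≫ σ ≫ va.inv ▷ p ≫ (α_ v r p).hom ≫ v ◁ ua.inv ≫ (α_ v u p').inv)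
    ((λ_ q').hom ≫ vb.inv ≫ v ◁ ub.inv ≫ (α_ v u q').inv) (by
      calc
        _ = (λ_ p').hom ▷ f ≫ σ ▷ f ⊗≫ va.inv ▷ p ▷ f ⊗≫ v ◁ ua.inv ▷ f ⊗≫ v ◁ (u ◁ lam') ⊗≫
            𝟙 _ := by rw [restrict]; bicategory
        _ = (λ_ p').hom ▷ f ≫ σ ▷ f ⊗≫ va.inv ▷ p ▷ f ⊗≫ v ◁ (ua.inv ≫ ua.hom) ▷ f ⊗≫
            v ◁ r ◁ phi ⊗≫ (v ◁ lam) ▷ g ⊗≫ v ◁ ub.inv ▷ (x ≫ g) ⊗≫ 𝟙 _ := by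
          rw [hu']; bicategory
        _ = (λ_ p').hom ▷ f ≫ σ ▷ f ⊗≫ (va.inv ▷ (p ≫ f) ≫ (v ≫ r) ◁ phi) ⊗≫ va.hom ▷ q ▷ g ⊗≫
            τ ▷ g ⊗≫ vb.inv ▷ (x ≫ g) ⊗≫ v ◁ ub.inv ▷ (x ≫ g) ⊗≫ 𝟙 _ := by
          rw [ua.inv_hom_id, hv']; bicategory
        _ = (λ_ p').hom ▷ f ≫ σ ▷ f ⊗≫ m ◁ phi ⊗≫ (va.inv ≫ va.hom) ▷ q ▷ g ⊗≫
            τ ▷ g ⊗≫ vb.inv ▷ (x ≫ g) ⊗≫ v ◁ ub.inv ▷ (x ≫ g) ⊗≫ 𝟙 _ := by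
          rw [← whisker_exchange]; bicategory
        _ = (λ_ p').hom ▷ f ≫ (σ ▷ f ≫ (α_ m p f).hom ≫ m ◁ phi ≫ (α_ m q g).inv ≫ τ ▷ g ≫
            (α_ q' x g).hom) ⊗≫ vb.inv ▷ (x ≫ g) ⊗≫ v ◁ ub.inv ▷ (x ≫ g) ⊗≫ 𝟙 _ := by
          rw [va.inv_hom_id]; bicategory
        _ = _ := by rw [hστ', restrict]; bicategory)
  -- `lam` is factored through the restriction of `τ` along `u`. The prescribed image under `g` is
  -- forced by compatibility of `δ` and `u ◁ σ` with `phi`; solving for it uses `inv phi`.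
  obtain ⟨δ, ⟨hδg, hδτ⟩, -⟩ := hτ u (r ≫ q) (lam ≫ ub.inv ▷ x ≫ (α_ u q' x).hom)
    ((α_ r q g).hom ≫ r ◁ inv phi ≫ (α_ r p f).inv ≫ ua.inv ▷ f ≫ (u ◁ σ) ▷ f ≫
      (α_ u (m ≫ p) f).hom ≫ u ◁ restrict m phi ≫ (α_ u (m ≫ q) g).inv) (by
      calc
        _ = (α_ r q g).hom ≫ r ◁ inv phi ⊗≫ ua.inv ▷ f ⊗≫ u ◁ (σ ▷ f ≫ (α_ m p f).hom ≫
            m ◁ phi ≫ (α_ m q g).inv ≫ τ ▷ g ≫ (α_ q' x g).hom) ⊗≫ 𝟙 _ := by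
          rw [restrict]; bicategory
        _ = (α_ r q g).hom ≫ r ◁ inv phi ⊗≫ (ua.inv ≫ ua.hom) ▷ f ⊗≫ r ◁ phi ⊗≫ lam ▷ g ⊗≫
            ub.inv ▷ (x ≫ g) ⊗≫ 𝟙 _ := by
          rw [hστ', hu']; bicategory
        _ = (α_ r q g).hom ≫ r ◁ (inv phi ≫ phi) ⊗≫ lam ▷ g ⊗≫ ub.inv ▷ (x ≫ g) ⊗≫ 𝟙 _ := by
          rw [ua.inv_hom_id]; bicategory
        _ = _ := by rw [IsIso.inv_hom_id]; bicategory)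
  obtain ⟨θr, ⟨hθp, hθq⟩, -⟩ := hphi r (u ≫ m) (ua.inv ≫ u ◁ σ ≫ (α_ u m p).inv)
    (δ ≫ (α_ u m q).inv) (by
      calc
        _ = ua.inv ▷ f ≫ (u ◁ σ) ▷ f ⊗≫ u ◁ m ◁ phi ⊗≫ 𝟙 _ := by rw [restrict]; bicategory
        _ = (α_ r p f).hom ≫ r ◁ (phi ≫ inv phi) ⊗≫ ua.inv ▷ f ⊗≫ (u ◁ σ) ▷ f ⊗≫
            u ◁ m ◁ phi ⊗≫ 𝟙 _ := by
          rw [IsIso.hom_inv_id]; bicategory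
        _ = _ := by
          rw [comp_whiskerRight, hδg, restrict, restrict]; bicategory)
  obtain ⟨θ, ⟨hθr, hθs⟩, -⟩ := hlam.liftsTwoCells (𝟙 W) (u ≫ v)
    ((λ_ r).hom ≫ θr ≫ u ◁ va.inv ≫ (α_ u v r).inv)
    ((λ_ s).hom ≫ ub.inv ≫ u ◁ vb.inv ≫ (α_ u v s).inv) (by
      calc
        _ = (λ_ r).hom ▷ q ≫ θr ▷ q ⊗≫ u ◁ va.inv ▷ q ⊗≫ u ◁ (v ◁ lam) ⊗≫ 𝟙 _ := by
          rw [restrict]; bicategory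
        _ = (λ_ r).hom ▷ q ≫ δ ⊗≫ u ◁ (va.inv ≫ va.hom) ▷ q ⊗≫ u ◁ τ ⊗≫ u ◁ vb.inv ▷ x ⊗≫
            𝟙 _ := by
          rw [hθq, hv']; bicategory
        _ = (λ_ r).hom ▷ q ≫ (δ ≫ u ◁ τ) ⊗≫ u ◁ vb.inv ▷ x ⊗≫ 𝟙 _ := by
          rw [va.inv_hom_id]; bicategory
        _ = _ := by rw [hδτ, restrict]; bicategory)
  -- Up to the same isomorphisms, both sides are `u ◁ σ` over `A` and the identity over `D`.
  have hηθ : (λ_ u).inv ≫ θ ▷ u ≫ (α_ u v u).hom = (ρ_ u).inv ≫ u ◁ η := by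
    apply hlam'.liftsTwoCells.hom_ext
    · calc
        _ = 𝟙 _ ⊗≫ θ ▷ (u ≫ p') ⊗≫ u ◁ v ◁ (ua.hom ≫ ua.inv) ⊗≫ 𝟙 _ := by
          rw [ua.hom_inv_id]; bicategory
        _ = 𝟙 _ ⊗≫ (θ ▷ (u ≫ p') ≫ (u ≫ v) ◁ ua.hom) ⊗≫ u ◁ v ◁ ua.inv ⊗≫ 𝟙 _ := by
          bicategory
        _ = 𝟙 _ ⊗≫ ua.hom ⊗≫ (θ ▷ r) ▷ p ⊗≫ u ◁ v ◁ ua.inv ⊗≫ 𝟙 _ := by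
          rw [← whisker_exchange]; bicategory
        _ = 𝟙 _ ⊗≫ ua.hom ⊗≫ θr ▷ p ⊗≫ u ◁ va.inv ▷ p ⊗≫ u ◁ v ◁ ua.inv ⊗≫ 𝟙 _ := by
          rw [hθr]; bicategory
        _ = 𝟙 _ ⊗≫ (ua.hom ≫ ua.inv) ⊗≫ u ◁ σ ⊗≫ u ◁ va.inv ▷ p ⊗≫ u ◁ v ◁ ua.inv ⊗≫
            𝟙 _ := by
          rw [hθp]; bicategory
        _ = 𝟙 _ ⊗≫ u ◁ ((λ_ p').hom ≫ σ ≫ va.inv ▷ p ≫ (α_ v r p).hom ≫ v ◁ ua.inv ≫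
            (α_ v u p').inv) ⊗≫ 𝟙 _ := by
          rw [ua.hom_inv_id]; bicategory
        _ = _ := by rw [← hηp]; bicategory
    · calc
        _ = 𝟙 _ ⊗≫ θ ▷ (u ≫ q') ⊗≫ u ◁ v ◁ (ub.hom ≫ ub.inv) ⊗≫ 𝟙 _ := by
          rw [ub.hom_inv_id]; bicategory
        _ = 𝟙 _ ⊗≫ (θ ▷ (u ≫ q') ≫ (u ≫ v) ◁ ub.hom) ⊗≫ u ◁ v ◁ ub.inv ⊗≫ 𝟙 _ := by
          bicategory
        _ = 𝟙 _ ⊗≫ ub.hom ⊗≫ θ ▷ s ⊗≫ u ◁ v ◁ ub.inv ⊗≫ 𝟙 _ := by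
          rw [← whisker_exchange]; bicategory
        _ = 𝟙 _ ⊗≫ (ub.hom ≫ ub.inv) ⊗≫ u ◁ vb.inv ⊗≫ u ◁ v ◁ ub.inv ⊗≫ 𝟙 _ := by
          rw [hθs]; bicategory
        _ = 𝟙 _ ⊗≫ u ◁ ((λ_ q').hom ≫ vb.inv ≫ v ◁ ub.inv ≫ (α_ v u q').inv) ⊗≫ 𝟙 _ := by
          rw [ub.hom_inv_id]; bicategory
        _ = _ := by rw [← hηq]; bicategory
  have (t : D ⟶ V) : IsIso (η ▷ (q' ≫ t)) := by
    have : IsIso (η ▷ q') := by rw [hηq]; infer_instance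
    rw [whiskerRight_comp]
    infer_instance
  refine isLan_of_whiskerLeft_bijective (u := u) ub
    ((α_ u p' h).symm ≪≫ whiskerRightIso ua h ≪≫ α_ r p h) (α_ x g l) hK
    (fun t => whiskerLeft_bijective u v η θ hηθ _ _) ?_
  symm
  calc
    _ = (u ◁ p' ◁ psi ⊗≫ (u ◁ lam') ▷ l) ⊗≫ ub.hom ▷ (x ≫ g) ▷ l ⊗≫ 𝟙 _ := by
      rw [paste]; bicategory
    _ = 𝟙 _ ⊗≫ ((u ≫ p') ◁ psi ≫ ua.hom ▷ (f ≫ l)) ⊗≫ r ◁ phi ▷ l ⊗≫ lam ▷ (g ≫ l) ⊗≫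
        (ub.inv ≫ ub.hom) ▷ (x ≫ g) ▷ l ⊗≫ 𝟙 _ := by
      rw [hu']; bicategory
    _ = _ := by
      rw [whisker_exchange, ub.inv_hom_id, paste, paste]
      simp only [Iso.trans_hom, Iso.symm_hom, whiskerRightIso_hom]
      bicategory

end Exactness

/-! ### Cartesian 2-cells, equivalences and bipullbacks -/

section Lifting

variable {K : Type u} [Bicategory.{w, v} K]

theorem isCartesian_of_isIso {A C X : K} (f : A ⟶ C) {x y : X ⟶ A} (alpha : x ⟶ y)
    [IsIso alpha] : IsCartesian f alpha := by
  intro Y k z β γ e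
  refine ⟨β ≫ inv (k ◁ alpha), ⟨?_, by simp⟩, fun δ hδ => by simp [← hδ.2]⟩
  rw [comp_whiskerRight, ← e]
  simp

theorem IsCartesian.isIso_comp {A C X : K} {f : A ⟶ C} {x y z : X ⟶ A} {ι : x ⟶ y} [IsIso ι]
    {alpha : y ⟶ z} (h : IsCartesian f alpha) : IsCartesian f (ι ≫ alpha) := by
  intro Y k t β γ e
  obtain ⟨δ, ⟨hδ, hδ'⟩, hu⟩ := h k t β (γ ≫ (k ◁ ι) ▷ f) (by simpa using e)
  refine ⟨δ ≫ inv (k ◁ ι), ⟨?_, ?_⟩, ?_⟩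
  · rw [comp_whiskerRight, hδ, Category.assoc, ← comp_whiskerRight]
    simp
  · simpa using hδ'
  · rintro ζ ⟨hζ, hζ'⟩
    rw [← hu (ζ ≫ k ◁ ι) ⟨by rw [comp_whiskerRight, hζ], by simpa using hζ'⟩]
    simp

/-- Every invertible square over the cospan `f`, `g` is, up to isomorphism, the restriction of `phi`
along a 1-cell. -/
def LiftsIsoSquares {P A B C : K} {f : A ⟶ C} {g : B ⟶ C} {p : P ⟶ A} {q : P ⟶ B}
    (phi : p ≫ f ⟶ q ≫ g) : Prop :=
  ∀ ⦃X : K⦄ (a : X ⟶ A) (b : X ⟶ B) (alpha : a ≫ f ≅ b ≫ g),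
    ∃ (m : X ⟶ P) (ia : m ≫ p ≅ a) (ib : m ≫ q ≅ b),
      restrict m phi ≫ ib.hom ▷ g = ia.hom ▷ f ≫ alpha.hom

/-- Pushing `a` forward along `β`, or pulling `b` back along it, leaves an invertible square, which
lifts to `P`. In the first case `τ` is invertible, hence cartesian. -/
theorem LiftsIsoSquares.factorsLaxSquares {P A B C : K} {f : A ⟶ C} {g : B ⟶ C} {p : P ⟶ A}
    {q : P ⟶ B} {phi : p ≫ f ⟶ q ≫ g} (h : LiftsIsoSquares phi)
    (hfg : IsBiOpfibration f ∨ IsBiFibration g) : FactorsLaxSquares phi := by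
  intro X a b β
  rcases hfg with hf | hg
  · obtain ⟨a', ι, σ, -, hσ⟩ := hf a (b ≫ g) β
    obtain ⟨m, ia, ib, hm⟩ := h a' b ι.symm
    refine ⟨m, σ ≫ ia.inv, ib.hom, isCartesian_of_isIso g _, ?_⟩
    rw [hm, comp_whiskerRight, hσ]
    simp
  · obtain ⟨b', ι, τ, hτ, hτg⟩ := hg b (a ≫ f) β
    obtain ⟨m, ia, ib, hm⟩ := h a b' ι.symm
    refine ⟨m, ia.inv, ib.hom ≫ τ, hτ.isIso_comp, ?_⟩
    rw [comp_whiskerRight, reassoc_of% hm, hτg]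
    simp

theorem eq_conj_unit_whiskerRight {W W' X : K} {h : W ⟶ W'} {k : W' ⟶ W} (i : 𝟙 W ≅ h ≫ k)
    {u v : X ⟶ W} (θ : u ⟶ v) : θ = (ρ_ u).inv ≫ u ◁ i.hom ≫ (α_ u h k).inv ≫ θ ▷ h ▷ k ≫
      (α_ v h k).hom ≫ v ◁ i.inv ≫ (ρ_ v).hom := by
  calc
    _ = 𝟙 _ ⊗≫ θ ▷ 𝟙 W ≫ v ◁ (i.hom ≫ i.inv) ⊗≫ 𝟙 _ := by rw [i.hom_inv_id]; bicategory
    _ = 𝟙 _ ⊗≫ (θ ▷ 𝟙 W ≫ v ◁ i.hom) ≫ v ◁ i.inv ⊗≫ 𝟙 _ := by bicategory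
    _ = _ := by rw [← whisker_exchange]; bicategory

theorem whiskerRight_injective {W W' X : K} {h : W ⟶ W'} {k : W' ⟶ W} (i : 𝟙 W ≅ h ≫ k)
    (u v : X ⟶ W) : Function.Injective fun θ : u ⟶ v => θ ▷ h := by
  intro θ θ' e
  rw [eq_conj_unit_whiskerRight i θ, eq_conj_unit_whiskerRight i θ']
  exact congrArg (fun ζ => (ρ_ u).inv ≫ u ◁ i.hom ≫ (α_ u h k).inv ≫ ζ ▷ k ≫
    (α_ v h k).hom ≫ v ◁ i.inv ≫ (ρ_ v).hom) e

theorem whiskerRight_equivalence_bijective {W W' X : K} (e : W ≌ W') (u v : X ⟶ W) :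
    Function.Bijective fun θ : u ⟶ v => θ ▷ e.hom := by
  refine ⟨whiskerRight_injective e.unit u v, fun ρ => ?_⟩
  let θ : u ⟶ v := (ρ_ u).inv ≫ u ◁ e.unit.hom ≫ (α_ u e.hom e.inv).inv ≫ ρ ▷ e.inv ≫
    (α_ v e.hom e.inv).hom ≫ v ◁ e.unit.inv ≫ (ρ_ v).hom
  -- Cancelling units in the conjugation formula for `θ` gives equality after whiskering with
  -- `e.inv`, which is itself faithful by the counit; no triangle identity is used.
  refine ⟨θ, whiskerRight_injective e.counit.symm _ _ ?_⟩
  have hθ := (eq_conj_unit_whiskerRight e.unit θ).symm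
  simp only [θ] at hθ
  rw [cancel_epi, cancel_epi, cancel_epi, cancel_mono] at hθ
  exact hθ

theorem IsBipullback.liftsIsoSquares {P A B C : K} {f : A ⟶ C} {g : B ⟶ C} {p : P ⟶ A}
    {q : P ⟶ B} {phi : p ≫ f ≅ q ≫ g} (h : IsBipullback f g p q phi) :
    LiftsIsoSquares phi.hom := by
  obtain ⟨W, p', q', lam, hlam, e, he⟩ := h
  obtain ⟨ja, jb, hj⟩ := he.exists_iso
  intro X a b alpha
  obtain ⟨n, hn, -⟩ := hlam.existsUnique_lift a b alpha
  obtain ⟨ia, ib, hi⟩ := hn.exists_iso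
  refine ⟨n ≫ e.inv, α_ _ _ _ ≪≫ whiskerLeftIso n (whiskerLeftIso e.inv ja.symm ≪≫
    (α_ _ _ _).symm ≪≫ whiskerRightIso e.counit p' ≪≫ λ_ p') ≪≫ ia,
    α_ _ _ _ ≪≫ whiskerLeftIso n (whiskerLeftIso e.inv jb.symm ≪≫
    (α_ _ _ _).symm ≪≫ whiskerRightIso e.counit q' ≪≫ λ_ q') ≪≫ ib, ?_⟩
  have hphi : phi.hom = ja.inv ▷ f ≫ restrict e.hom lam.hom ≫ jb.hom ▷ g := by
    rw [hj]
    simp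
  simp only [Iso.trans_hom, whiskerLeftIso_hom, Iso.symm_hom, whiskerRightIso_hom]
  calc
    _ = 𝟙 _ ⊗≫ n ◁ e.inv ◁ ja.inv ▷ f ⊗≫ n ◁ (e.inv ≫ e.hom) ◁ lam.hom ⊗≫
        n ◁ e.inv ◁ (jb.hom ≫ jb.inv) ▷ g ⊗≫ n ◁ e.counit.hom ▷ (q' ≫ g) ⊗≫ ib.hom ▷ g := by
      rw [restrict, hphi, restrict]; bicategory
    _ = 𝟙 _ ⊗≫ n ◁ e.inv ◁ ja.inv ▷ f ⊗≫ n ◁ ((e.inv ≫ e.hom) ◁ lam.hom ≫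
        e.counit.hom ▷ (q' ≫ g)) ⊗≫ ib.hom ▷ g := by
      rw [jb.hom_inv_id]; bicategory
    _ = 𝟙 _ ⊗≫ n ◁ e.inv ◁ ja.inv ▷ f ⊗≫ n ◁ e.counit.hom ▷ (p' ≫ f) ⊗≫
        (restrict n lam.hom ≫ ib.hom ▷ g) := by
      rw [whisker_exchange, restrict]; bicategory
    _ = _ := by rw [hi]; bicategory

/-- The property transfers from the isocomma object, since whiskering with an equivalence is
bijective on 2-cells. -/
theorem IsBipullback.liftsTwoCells {P A B C : K} {f : A ⟶ C} {g : B ⟶ C} {p : P ⟶ A}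
    {q : P ⟶ B} {phi : p ≫ f ≅ q ≫ g} (h : IsBipullback f g p q phi) :
    LiftsTwoCells phi.hom := by
  obtain ⟨W, p', q', lam, hlam, e, he⟩ := h
  obtain ⟨ja, jb, hj⟩ := he.exists_iso
  have hlam' : e.hom ◁ lam.hom = (α_ _ _ _).inv ≫ (ja.hom ▷ f ≫ phi.hom ≫ jb.inv ▷ g) ≫
      (α_ _ _ _).hom := by
    rw [← reassoc_of% hj, restrict]
    simp
  intro X u v σ τ hστ
  obtain ⟨ρ, ⟨hρp, hρq⟩, hρ⟩ := hlam.liftsTwoCells (u ≫ e.hom) (v ≫ e.hom)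
    ((α_ _ _ _).hom ≫ u ◁ ja.hom ≫ σ ≫ v ◁ ja.inv ≫ (α_ _ _ _).inv)
    ((α_ _ _ _).hom ≫ u ◁ jb.hom ≫ τ ≫ v ◁ jb.inv ≫ (α_ _ _ _).inv) (by
      calc
        _ = 𝟙 _ ⊗≫ u ◁ ja.hom ▷ f ⊗≫ σ ▷ f ⊗≫ v ◁ ja.inv ▷ f ⊗≫ v ◁ (e.hom ◁ lam.hom) ⊗≫
            𝟙 _ := by
          rw [restrict]; bicategory
        _ = 𝟙 _ ⊗≫ u ◁ ja.hom ▷ f ⊗≫ σ ▷ f ⊗≫ v ◁ (ja.inv ≫ ja.hom) ▷ f ⊗≫ v ◁ phi.hom ⊗≫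
            v ◁ jb.inv ▷ g ⊗≫ 𝟙 _ := by
          rw [hlam']; bicategory
        _ = 𝟙 _ ⊗≫ u ◁ ja.hom ▷ f ⊗≫ (σ ▷ f ≫ restrict v phi.hom) ⊗≫ v ◁ jb.inv ▷ g ⊗≫
            𝟙 _ := by
          rw [ja.inv_hom_id, restrict]; bicategory
        _ = 𝟙 _ ⊗≫ u ◁ ja.hom ▷ f ⊗≫ u ◁ phi.hom ⊗≫ u ◁ (𝟙 q) ▷ g ⊗≫ τ ▷ g ⊗≫
            v ◁ jb.inv ▷ g ⊗≫ 𝟙 _ := by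
          rw [hστ, restrict]; bicategory
        _ = 𝟙 _ ⊗≫ u ◁ (e.hom ◁ lam.hom) ⊗≫ u ◁ jb.hom ▷ g ⊗≫ τ ▷ g ⊗≫
            v ◁ jb.inv ▷ g ⊗≫ 𝟙 _ := by
          rw [← jb.inv_hom_id, hlam']; bicategory
        _ = _ := by rw [restrict]; bicategory)
  have hwp (θ : u ⟶ v) : θ ▷ e.hom ▷ p' =
      (α_ _ _ _).hom ≫ u ◁ ja.hom ≫ θ ▷ p ≫ v ◁ ja.inv ≫ (α_ _ _ _).inv := by
    rw [whisker_exchange_assoc]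
    simp
  have hwq (θ : u ⟶ v) : θ ▷ e.hom ▷ q' =
      (α_ _ _ _).hom ≫ u ◁ jb.hom ≫ θ ▷ q ≫ v ◁ jb.inv ≫ (α_ _ _ _).inv := by
    rw [whisker_exchange_assoc]
    simp
  obtain ⟨hinj, hsurj⟩ := whiskerRight_equivalence_bijective e u v
  obtain ⟨θ, rfl⟩ := hsurj ρ
  refine ⟨θ, ⟨?_, ?_⟩, fun θ' hθ' => hinj (hρ (θ' ▷ e.hom) ⟨?_, ?_⟩)⟩
  · have := (hwp θ).symm.trans hρp
    rwa [cancel_epi, cancel_epi, cancel_mono] at this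
  · have := (hwq θ).symm.trans hρq
    rwa [cancel_epi, cancel_epi, cancel_mono] at this
  · rw [hwp, hθ'.1]
  · rw [hwq, hθ'.2]

end Lifting

/-! ### Strict pullbacks -/

section Strict

variable {K : Type u} [Bicategory.{w, v} K] [Bicategory.Strict K]

/-- A strict pullback need not lift invertible squares, but strict (op)fibrations leave a square
that commutes on the nose. -/
theorem IsTwoPullback.factorsLaxSquares {P A B C : K} {f : A ⟶ C} {g : B ⟶ C} {p : P ⟶ A}
    {q : P ⟶ B} (h : IsTwoPullback f g p q) (hfg : IsOpfibration f ∨ IsFibration g) :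
    FactorsLaxSquares (f := f) (g := g) (eqToHom h.isPullback.w) := by
  have hr {X : K} (m : X ⟶ P) {a : X ⟶ A} {b : X ⟶ B} (ha : m ≫ p = a) (hb : m ≫ q = b)
      (e : a ≫ f = b ≫ g) : restrict (f := f) (g := g) m (eqToHom h.isPullback.w) =
        eqToHom ha ▷ f ≫ eqToHom e ≫ eqToHom hb.symm ▷ g := by
    simp [restrict, Strict.associator_eqToIso]
  intro X a b β
  rcases hfg with hf | hg
  · obtain ⟨a', hb, σ, -, hσ⟩ := hf a (b ≫ g) β
    obtain ⟨m, ha, hb'⟩ : ∃ m : X ⟶ P, m ≫ p = a' ∧ m ≫ q = b :=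
      ⟨h.isPullback.lift a' b hb.symm, h.isPullback.lift_fst _ _ _, h.isPullback.lift_snd _ _ _⟩
    refine ⟨m, σ ≫ eqToHom ha.symm, eqToHom hb', isCartesian_of_isIso g _, ?_⟩
    rw [hr m ha hb' hb.symm, comp_whiskerRight, hσ]
    simp
  · obtain ⟨b', hb, τ, hτ, hτg⟩ := hg b (a ≫ f) β
    obtain ⟨m, ha, hb'⟩ : ∃ m : X ⟶ P, m ≫ p = a ∧ m ≫ q = b' :=
      ⟨h.isPullback.lift a b' hb.symm, h.isPullback.lift_fst _ _ _, h.isPullback.lift_snd _ _ _⟩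
    refine ⟨m, eqToHom ha.symm, eqToHom hb' ≫ τ, hτ.isIso_comp, ?_⟩
    rw [hr m ha hb' hb.symm, comp_whiskerRight, hτg]
    simp

end Strict

end ExactSquares

theorem proposition4p9 {K : Type u} [Bicategory.{w, v} K] [Bicategory.Strict K]
    (hcomma : ExactSquares.HasCommaObjects K) (hpullback : ExactSquares.HasTwoPullbacks K) :
    (∀ {P A B C : K} (f : A ⟶ C) (g : B ⟶ C) (p : P ⟶ A) (q : P ⟶ B)
      (hpb : ExactSquares.IsTwoPullback f g p q),
      ExactSquares.IsOpfibration f ∨ ExactSquares.IsFibration g →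
        ExactSquares.IsExact f g p q (eqToHom hpb.isPullback.w)) ∧
    (ExactSquares.HasIsocommaObjects K →
      ∀ {P A B C : K} (f : A ⟶ C) (g : B ⟶ C) (p : P ⟶ A) (q : P ⟶ B) (phi : p ≫ f ≅ q ≫ g),
        ExactSquares.IsBipullback f g p q phi →
        ExactSquares.IsBiOpfibration f ∨ ExactSquares.IsBiFibration g →
          ExactSquares.IsExact f g p q phi.hom) := by
  refine ⟨fun _ _ _ _ hpb hfg => (hpb.factorsLaxSquares hfg).isExact hcomma hpb.liftsTwoCells, ?_⟩
  intro _ P A B C f g p q phi h hfg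
  exact (h.liftsIsoSquares.factorsLaxSquares hfg).isExact hcomma h.liftsTwoCells
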